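/- All graphs are finite and simple. A \emph{double subdivision} of an edge $pq$ of a graph $G$ produces the graph obtained from $G-pq$ by adding two new vertices and joining both of them to $p$ and $q$. A \emph{generalised triangle} is $K_3$ or any graph (up to isomorphism) obtained from $K_3$ by a sequence of double subdivisions. A \emph{2-cut} of $G$ is a set $\{x,y\}$ of two distinct vertices whose removal increases the number of components; an $\{x,y\}$-\emph{bridge} is a subgraph $G[V(C)\cup\{x,y\}]$ with $C$ a connected component of $G-\{x,y\}$, and it is \emph{trivial} if it has exactly three vertices. Let $\mathcal{K}_2$ be the class of generalised triangles $G$ such that, for every 2-cut $\{x,y\}$ of $G$, at least one $\{x,y\}$-bridge is trivial. Consider $K_{2,3}$ with parts $\{x,y\}$ and $\{u,v,w\}$; let $H_1$ be the graph formed from it by doubly subdividing the edges $xu,xv,xw$, and let $H_2$ be the graph formed from it by doubly subdividing the edges $xu,xv,yw$. Lemma. If $G$ is a generalised triangle, then $G\in\mathcal{K}_2$ if and only if $G$ is $\{H_1,H_2\}$-minor-free, i.e. neither $H_1$ nor $H_2$ is a minor of $G$. -/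

import Mathlib

namespace GenTriangle

universe u v

/-- The double subdivision of `G` at `pq` (meant for an edge `pq` of `G`): remove the edge `pq`,
add two new vertices, and join both of them to `p` and to `q`. -/
def doubleSubdivision {V : Type u} (G : SimpleGraph V) (p q : V) : SimpleGraph (V ⊕ Fin 2) where
  Adj a b :=
    match a, b with
    | Sum.inl a, Sum.inl b => (G.deleteEdges {s(p, q)}).Adj a b
    | Sum.inl a, Sum.inr _ => a = p ∨ a = q
    | Sum.inr _, Sum.inl b => b = p ∨ b = q
    | Sum.inr _, Sum.inr _ => False
  symm := ⟨by
    rintro (a | i) (b | j) h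
    · exact SimpleGraph.Adj.symm (G := G.deleteEdges {s(p, q)}) h
    · exact h
    · exact h
    · exact h⟩
  loopless := ⟨by
    rintro (a | i) h
    · exact (G.deleteEdges {s(p, q)}).loopless.irrefl a h
    · exact h⟩

/-- Generalised triangles: the graphs isomorphic to `K₃`, or obtained (up to isomorphism) from it
by a sequence of double subdivisions of edges. -/
inductive IsGeneralisedTriangle : {V : Type u} → SimpleGraph V → Prop
  | triangle {V : Type u} (G : SimpleGraph V)
      (e : G ≃g (⊤ : SimpleGraph (Fin 3))) : IsGeneralisedTriangle G
  | subdivide {V W : Type u} (G : SimpleGraph V) (G' : SimpleGraph W) (p q : V)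
      (hG : IsGeneralisedTriangle G) (hpq : G.Adj p q)
      (e : G' ≃g doubleSubdivision G p q) : IsGeneralisedTriangle G'

/-- A set of vertices is a cut-set if its removal increases the number of components. -/
def IsCutSet {V : Type u} (G : SimpleGraph V) (S : Set V) : Prop :=
  ENat.card G.ConnectedComponent < ENat.card (G.induce Sᶜ).ConnectedComponent

/-- `{x, y}` is a 2-cut of `G`. -/
def IsTwoCut {V : Type u} (G : SimpleGraph V) (x y : V) : Prop :=
  x ≠ y ∧ IsCutSet G {x, y}

/-- `B` is an `{x, y}`-bridge of `G`: the subgraph induced on `V(C) ∪ {x, y}` for some connected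
component `C` of `G - {x, y}`. -/
def IsBridge {V : Type u} (G : SimpleGraph V) (x y : V) (B : G.Subgraph) : Prop :=
  ∃ C : (G.induce ({x, y}ᶜ : Set V)).ConnectedComponent,
    B = (⊤ : G.Subgraph).induce (Subtype.val '' C.supp ∪ {x, y})

/-- Property `P₂` of a 2-cut `{x, y}`: at least one `{x, y}`-bridge is trivial, i.e. has exactly
three vertices. -/
def HasP2 {V : Type u} (G : SimpleGraph V) (x y : V) : Prop :=
  ∃ B : G.Subgraph, IsBridge G x y B ∧ B.verts.ncard = 3

/-- The family `𝒦₂` of generalised triangles with property `P₂` at every 2-cut. -/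
def InK2 {V : Type u} (G : SimpleGraph V) : Prop :=
  IsGeneralisedTriangle G ∧ ∀ x y : V, IsTwoCut G x y → HasP2 G x y

/-- `H` is a minor of `G`: there are pairwise disjoint, connected (in particular non-empty) branch
sets in `G`, one for each vertex of `H`, with an edge of `G` between the branch sets of any two
adjacent vertices of `H`. -/
def IsMinor {W : Type v} {V : Type u} (H : SimpleGraph W) (G : SimpleGraph V) : Prop :=
  ∃ B : W → Set V,
    (∀ a, (G.induce (B a)).Connected) ∧
    (∀ a b, a ≠ b → Disjoint (B a) (B b)) ∧
    (∀ a b, H.Adj a b → ∃ s ∈ B a, ∃ t ∈ B b, G.Adj s t)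

/-- `K₂,₃`, with parts `{x, y}` (`x = inl 0`, `y = inl 1`) and `{u, v, w}`
(`u = inr 0`, `v = inr 1`, `w = inr 2`). -/
abbrev K23 : SimpleGraph (Fin 2 ⊕ Fin 3) := completeBipartiteGraph (Fin 2) (Fin 3)

/-- An old vertex of `K₂,₃` after one double subdivision. -/
abbrev old1 (a : Fin 2 ⊕ Fin 3) : (Fin 2 ⊕ Fin 3) ⊕ Fin 2 := Sum.inl a

/-- An old vertex of `K₂,₃` after two double subdivisions. -/
abbrev old2 (a : Fin 2 ⊕ Fin 3) : ((Fin 2 ⊕ Fin 3) ⊕ Fin 2) ⊕ Fin 2 := Sum.inl (old1 a)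

/-- `H₁`: `K₂,₃` with the edges `xu`, `xv` and `xw` doubly subdivided. -/
def H1 : SimpleGraph ((((Fin 2 ⊕ Fin 3) ⊕ Fin 2) ⊕ Fin 2) ⊕ Fin 2) :=
  doubleSubdivision
    (doubleSubdivision
      (doubleSubdivision K23 (Sum.inl 0) (Sum.inr 0))
      (old1 (Sum.inl 0)) (old1 (Sum.inr 1)))
    (old2 (Sum.inl 0)) (old2 (Sum.inr 2))

/-- `H₂`: `K₂,₃` with the edges `xu`, `xv` and `yw` doubly subdivided. -/
def H2 : SimpleGraph ((((Fin 2 ⊕ Fin 3) ⊕ Fin 2) ⊕ Fin 2) ⊕ Fin 2) :=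
  doubleSubdivision
    (doubleSubdivision
      (doubleSubdivision K23 (Sum.inl 0) (Sum.inr 0))
      (old1 (Sum.inl 0)) (old1 (Sum.inr 1)))
    (old2 (Sum.inl 1)) (old2 (Sum.inr 2))

end GenTriangle

/-!
Every 2-cut of a generalised triangle leaves exactly three components, each of which is a single
vertex or contains a doubled path between the cut vertices; this follows by induction along the
double subdivisions. If no bridge of a 2-cut is trivial, the directions of the three doubled paths
determine, up to symmetry, whether they form `H1` or `H2`.

Conversely, `H1` and `H2` both contain three paths of length three with common ends, so a model of
either gives three edges joining disjoint connected sets `X` and `Y`. Again by induction, such edges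
lie in three distinct bridges of some 2-cut with one vertex in each of `X` and `Y`. Connectedness
then forces the cut vertices into the branch sets of the two path ends, so each bridge also meets
two further branch sets and is nontrivial.
-/

namespace GenTriangle

universe u v

section Connectivity

variable {V : Type u} {V' : Type v} {G : SimpleGraph V} {G' : SimpleGraph V'} {S T P : Set V}

lemma subset_of_preconnected_of_forall_adj (hS : (G.induce S).Preconnected)
    (hP : ∀ v ∈ S ∩ P, ∀ w ∈ S, G.Adj v w → w ∈ P) (hne : (S ∩ P).Nonempty) : S ⊆ P := by
  obtain ⟨a, haS, haP⟩ := hne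
  suffices h : ∀ w : S, (w : V) ∈ P from fun w hw => h ⟨w, hw⟩
  intro w
  have hreach := (SimpleGraph.reachable_iff_reflTransGen _ _).1 (hS ⟨a, haS⟩ w)
  induction hreach with
  | refl => exact haP
  | @tail b c _ hbc ih => exact hP b ⟨b.2, ih⟩ c c.2 hbc

lemma connected_induce_of_forall_subset (hne : S.Nonempty)
    (h : ∀ P : Set V, (∀ v ∈ S ∩ P, ∀ w ∈ S, G.Adj v w → w ∈ P) → (S ∩ P).Nonempty → S ⊆ P) :
    (G.induce S).Connected := by
  obtain ⟨a, ha⟩ := hne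
  refine SimpleGraph.connected_iff_exists_forall_reachable _ |>.2 ⟨⟨a, ha⟩, fun ⟨w, hw⟩ => ?_⟩
  refine (h {v | ∃ hv : v ∈ S, (G.induce S).Reachable ⟨a, ha⟩ ⟨v, hv⟩} ?_
    ⟨a, ha, ha, .rfl⟩ hw).2
  rintro v ⟨-, hv, hav⟩ w hw hvw
  exact ⟨hw, hav.trans (SimpleGraph.Adj.reachable (G := G.induce S) hvw)⟩

lemma connected_induce_singleton (G : SimpleGraph V) (v : V) : (G.induce {v}).Connected :=
  .of_subsingleton

lemma connected_induce_of_forall_adj {c : V} (hc : c ∈ S) (h : ∀ v ∈ S, v ≠ c → G.Adj c v) :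
    (G.induce S).Connected := by
  refine .of_isUniversal (v := ⟨c, hc⟩) fun w hw => ?_
  exact h w w.2 fun h => hw (Subtype.ext h.symm)

lemma exists_adj_of_connected_induce {v : V} (hS : (G.induce S).Connected) (hv : v ∈ S)
    (hne : S ≠ {v}) : ∃ w ∈ S, G.Adj v w := by
  by_contra! h
  refine hne (Set.Subset.antisymm ?_ (Set.singleton_subset_iff.2 hv))
  refine subset_of_preconnected_of_forall_adj hS.preconnected ?_ ⟨v, hv, rfl⟩
  rintro _ ⟨-, rfl⟩ w hw hvw
  exact absurd hvw (h w hw)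

/-- Some edge of `G` joins `S` to `T`. -/
def Touches (G : SimpleGraph V) (S T : Set V) : Prop :=
  ∃ s ∈ S, ∃ t ∈ T, G.Adj s t

lemma Touches.symm : Touches G S T → Touches G T S
  | ⟨s, hs, t, ht, h⟩ => ⟨t, ht, s, hs, h.symm⟩

lemma touches_singleton {v w : V} : Touches G {v} {w} ↔ G.Adj v w := by
  simp [Touches]

lemma Touches.connected_union (h : Touches G S T) (hS : (G.induce S).Connected)
    (hT : (G.induce T).Connected) : (G.induce (S ∪ T)).Connected :=
  let ⟨_, hs, _, ht, hst⟩ := h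
  SimpleGraph.connected_induce_union hS.preconnected hT.preconnected hs ht hst

lemma connected_induce_biUnion {B : V → Set V'} (hS : (G.induce S).Connected)
    (hB : ∀ v ∈ S, (G'.induce (B v)).Connected)
    (hadj : ∀ v ∈ S, ∀ w ∈ S, G.Adj v w → Touches G' (B v) (B w)) :
    (G'.induce (⋃ v ∈ S, B v)).Connected := by
  have ⟨v₀, hv₀⟩ : S.Nonempty := Set.nonempty_coe_sort.1 hS.nonempty
  have ⟨a₀, ha₀⟩ : (B v₀).Nonempty := Set.nonempty_coe_sort.1 (hB v₀ hv₀).nonempty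
  refine connected_induce_of_forall_subset ⟨a₀, Set.mem_biUnion hv₀ ha₀⟩ fun P hP hne => ?_
  have fill {v a} (hv : v ∈ S) (ha : a ∈ B v) (haP : a ∈ P) : B v ⊆ P :=
    subset_of_preconnected_of_forall_adj (hB v hv).preconnected
      (fun b hb c hc => hP b ⟨Set.mem_biUnion hv hb.1, hb.2⟩ c (Set.mem_biUnion hv hc))
      ⟨a, ha, haP⟩
  obtain ⟨a, haS, haP⟩ := hne
  obtain ⟨v, hv, hav⟩ := Set.mem_iUnion₂.1 haS
  refine Set.iUnion₂_subset (subset_of_preconnected_of_forall_adj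
    (P := {v | B v ⊆ P}) hS.preconnected ?_ ⟨v, hv, fill hv hav haP⟩)
  rintro v ⟨hv, hvP⟩ w hw hvw
  obtain ⟨b, hb, c, hc, hbc⟩ := hadj v hv w hw hvw
  exact fill hw hc <|
    hP b ⟨Set.mem_biUnion hv hb, hvP hb⟩ c (Set.mem_biUnion hw hc) hbc

lemma isCutSet_iff (hG : G.Connected) : IsCutSet G S ↔ ¬(G.induce Sᶜ).Preconnected := by
  have hcard : ENat.card G.ConnectedComponent = 1 := by
    have := hG.preconnected.subsingleton_connectedComponent
    have := hG.nonempty.map G.connectedComponentMk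
    exact le_antisymm ((ENat.card_le_one_iff_subsingleton _).2 ‹_›)
      ((ENat.one_le_card_iff_nonempty _).2 ‹_›)
  rw [IsCutSet, hcard, ENat.one_lt_card_iff_nontrivial, ← not_subsingleton_iff_nontrivial,
    not_iff_not]
  refine ⟨fun h v w => ?_, (·.subsingleton_connectedComponent)⟩
  exact SimpleGraph.ConnectedComponent.exact (Subsingleton.elim _ _)

lemma image_supp_connectedComponentMk {C : Set V} (hC : (G.induce C).Connected)
    (hclosed : ∀ v ∈ C, ∀ w ∈ S, G.Adj v w → w ∈ C) (hCS : C ⊆ S) {v : S} (hv : ↑v ∈ C) :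
    (↑) '' ((G.induce S).connectedComponentMk v).supp = C := by
  refine Set.Subset.antisymm (Set.image_subset_iff.2 ?_) ?_
  · refine subset_of_preconnected_of_forall_adj
      (SimpleGraph.ConnectedComponent.connected_toSimpleGraph _).preconnected ?_ ⟨v, rfl, hv⟩
    exact fun a ha b _ hab => hclosed a ha.2 b b.2 hab
  · refine subset_of_preconnected_of_forall_adj hC.preconnected ?_ ⟨v, hv, v, rfl, rfl⟩
    rintro _ ⟨-, a, ha, rfl⟩ b hb hab
    exact ⟨⟨b, hCS hb⟩, SimpleGraph.ConnectedComponent.mem_supp_of_adj_mem_supp _ ha hab, rfl⟩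

end Connectivity

section Models

variable {V : Type u} {V' : Type v} {G : SimpleGraph V} {G' : SimpleGraph V'} {S C : Set V}
  {B : V → Set V'} {π : V' → V}

/-- The sets `B v` form a model in `G'` of the part of `G` around `C`: they are pairwise disjoint,
connected for `v ∈ C`, and every edge of `G` with an end in `C` is realised by an edge of `G'`. -/
structure IsModelOn (G : SimpleGraph V) (C : Set V) (G' : SimpleGraph V') (B : V → Set V') :
    Prop where
  connected : ∀ v ∈ C, (G'.induce (B v)).Connected
  disjoint : Pairwise fun v w => Disjoint (B v) (B w)
  touches : ∀ v, ∀ w ∈ C, G.Adj v w → Touches G' (B v) (B w)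

namespace IsModelOn

lemma mono (hB : IsModelOn G C G' B) (hS : S ⊆ C) : IsModelOn G S G' B where
  connected v hv := hB.connected v (hS hv)
  disjoint := hB.disjoint
  touches v w hw := hB.touches v w (hS hw)

lemma connected_biUnion (hB : IsModelOn G C G' B) (hC : (G.induce C).Connected) :
    (G'.induce (⋃ v ∈ C, B v)).Connected :=
  connected_induce_biUnion hC hB.connected fun v _ w hw => hB.touches v w hw

lemma disjoint_biUnion (hB : IsModelOn G C G' B) {S T : Set V} (h : Disjoint S T) :
    Disjoint (⋃ v ∈ S, B v) (⋃ w ∈ T, B w) := by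
  simp only [Set.disjoint_iUnion_left, Set.disjoint_iUnion_right]
  exact fun v hv w hw => hB.disjoint (h.ne_of_mem hw hv)

lemma touches_biUnion (hB : IsModelOn G C G' B) {S T : Set V} (hT : T ⊆ C) (h : Touches G S T) :
    Touches G' (⋃ v ∈ S, B v) (⋃ w ∈ T, B w) := by
  obtain ⟨v, hv, w, hw, hvw⟩ := h
  obtain ⟨a, ha, b, hb, hab⟩ := hB.touches v w (hT hw) hvw
  exact ⟨a, Set.mem_biUnion hv ha, b, Set.mem_biUnion hw hb, hab⟩

end IsModelOn

/-- `π` contracts `G'` onto `G`: its fibres are connected, and two distinct vertices of `G` are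
adjacent exactly when some edge of `G'` joins their fibres. -/
structure IsContraction (G' : SimpleGraph V') (G : SimpleGraph V) (π : V' → V) : Prop where
  connected : ∀ v, (G'.induce (π ⁻¹' {v})).Connected
  touches : ∀ v w, G.Adj v w → Touches G' (π ⁻¹' {v}) (π ⁻¹' {w})
  adj : ∀ a b, G'.Adj a b → π a ≠ π b → G.Adj (π a) (π b)

namespace IsContraction

lemma isModelOn (hπ : IsContraction G' G π) (C : Set V) :
    IsModelOn G C G' fun v => π ⁻¹' {v} where
  connected v _ := hπ.connected v
  disjoint _ _ hvw := (Set.disjoint_singleton.2 hvw).preimage π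
  touches v w _ := hπ.touches v w

lemma connected_preimage (hπ : IsContraction G' G π) (hS : (G.induce S).Connected) :
    (G'.induce (π ⁻¹' S)).Connected := by
  rw [← Set.biUnion_preimage_singleton]
  exact (hπ.isModelOn S).connected_biUnion hS

end IsContraction

lemma iso_preimage_singleton (e : G' ≃g G) (a : V') : e ⁻¹' {e a} = {a} := by
  ext
  simp

lemma isContraction_of_iso (e : G' ≃g G) : IsContraction G' G e := by
  refine ⟨e.surjective.forall.2 fun a => ?_, e.surjective.forall₂.2 fun a b hab => ?_,
    fun a b hab _ => e.map_adj_iff.2 hab⟩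
  · rw [iso_preimage_singleton]
    exact connected_induce_singleton G' a
  · rw [iso_preimage_singleton, iso_preimage_singleton, touches_singleton]
    exact e.map_adj_iff.1 hab

end Models

section TripleCuts

variable {V : Type u} {V' : Type v} {G : SimpleGraph V} {G' : SimpleGraph V'} {s t : V} {C : Set V}

/-- The sets `B 0`, `B 1`, `B 2` form a model, rooted at the vertices `x` and `y`, of the path
`x - B 2 - y` whose edge at `x` is doubly subdivided, the new vertices being `B 0` and `B 1`. -/
structure IsDoubledPath (G : SimpleGraph V) (x y : V) (B : Fin 3 → Set V) : Prop where
  connected : ∀ k, (G.induce (B k)).Connected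
  disjoint : Pairwise fun k l => Disjoint (B k) (B l)
  touches_left : ∀ k ≠ 2, Touches G {x} (B k)
  touches_mid : ∀ k ≠ 2, Touches G (B k) (B 2)
  touches_right : Touches G {y} (B 2)

/-- `C` contains the inner branch sets of a doubled path rooted at `x` and `y`. -/
def HasDoubledPath (G : SimpleGraph V) (x y : V) (C : Set V) : Prop :=
  ∃ B, IsDoubledPath G x y B ∧ ∀ k, B k ⊆ C

lemma HasDoubledPath.of_isModelOn {B : V → Set V'} {s' t' : V'} (h : HasDoubledPath G s t C)
    (hB : IsModelOn G C G' B) (hs : B s = {s'}) (ht : B t = {t'}) :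
    HasDoubledPath G' s' t' (⋃ v ∈ C, B v) := by
  obtain ⟨D, hD, hDC⟩ := h
  have touches_root {x x' T} (hx : B x = {x'}) (hT : T ⊆ C) (h : Touches G {x} T) :
      Touches G' {x'} (⋃ v ∈ T, B v) := by
    simpa [hx] using hB.touches_biUnion hT h
  exact ⟨fun k => ⋃ v ∈ D k, B v,
    { connected := fun k => (hB.mono (hDC k)).connected_biUnion (hD.connected k)
      disjoint := fun k l hkl => hB.disjoint_biUnion (hD.disjoint hkl)
      touches_left := fun k hk => touches_root hs (hDC k) (hD.touches_left k hk)
      touches_mid := fun k hk => hB.touches_biUnion (hDC 2) (hD.touches_mid k hk)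
      touches_right := touches_root ht (hDC 2) hD.touches_right },
    fun k => Set.biUnion_subset_biUnion_left (hDC k)⟩

/-- `C` is the vertex set of an `{s, t}`-bridge without `s` and `t`, and the bridge is trivial or
contains a doubled path rooted at `s` and `t`, in one of the two directions. -/
structure IsRichInterior (G : SimpleGraph V) (s t : V) (C : Set V) : Prop where
  connected : (G.induce C).Connected
  touches_left : Touches G {s} C
  touches_right : Touches G {t} C
  closed : ∀ v ∈ C, ∀ w, G.Adj v w → w ∉ C → w = s ∨ w = t
  doubled : C.Nontrivial → HasDoubledPath G s t C ∨ HasDoubledPath G t s C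

namespace IsRichInterior

lemma nonempty (h : IsRichInterior G s t C) : C.Nonempty :=
  Set.nonempty_coe_sort.1 h.connected.nonempty

lemma symm (h : IsRichInterior G s t C) : IsRichInterior G t s C where
  connected := h.connected
  touches_left := h.touches_right
  touches_right := h.touches_left
  closed v hv w hvw hw := (h.closed v hv w hvw hw).symm
  doubled hC := (h.doubled hC).symm

lemma of_isModelOn {B : V → Set V'} {s' t' : V'} (h : IsRichInterior G s t C)
    (hB : IsModelOn G C G' B) (hs : B s = {s'}) (ht : B t = {t'})
    (hclosed : ∀ a ∈ ⋃ v ∈ C, B v, ∀ b, G'.Adj a b → b ∉ ⋃ v ∈ C, B v → b = s' ∨ b = t')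
    (hsingle : ∀ v, C = {v} → (B v).Nontrivial →
      HasDoubledPath G' s' t' (B v) ∨ HasDoubledPath G' t' s' (B v)) :
    IsRichInterior G' s' t' (⋃ v ∈ C, B v) where
  connected := hB.connected_biUnion h.connected
  touches_left := by simpa [hs] using hB.touches_biUnion subset_rfl h.touches_left
  touches_right := by simpa [ht] using hB.touches_biUnion subset_rfl h.touches_right
  closed := hclosed
  doubled hnontrivial := by
    by_cases hC : C.Nontrivial
    · exact (h.doubled hC).imp (·.of_isModelOn hB hs ht) (·.of_isModelOn hB ht hs)
    · obtain ⟨v, rfl⟩ := Set.exists_eq_singleton_iff_nonempty_subsingleton.2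
        ⟨h.nonempty, Set.not_nontrivial_iff.1 hC⟩
      simp only [Set.biUnion_singleton] at hnontrivial ⊢
      exact hsingle v rfl hnontrivial

lemma preimage {π : V' → V} {s t : V'} (h : IsRichInterior G (π s) (π t) C)
    (hπ : IsContraction G' G π) (hs : π ⁻¹' {π s} = {s}) (ht : π ⁻¹' {π t} = {t})
    (hsingle : ∀ v, C = {v} → (π ⁻¹' {v}).Nontrivial →
      HasDoubledPath G' s t (π ⁻¹' {v}) ∨ HasDoubledPath G' t s (π ⁻¹' {v})) :
    IsRichInterior G' s t (π ⁻¹' C) := by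
  rw [← Set.biUnion_preimage_singleton]
  refine h.of_isModelOn (hπ.isModelOn C) hs ht ?_ hsingle
  rw [Set.biUnion_preimage_singleton]
  intro a ha b hab hb
  exact (h.closed _ ha _ (hπ.adj a b hab fun hπab => hb (hπab ▸ ha : π b ∈ C)) hb).imp
    (fun h => hs.subset h) (fun h => ht.subset h)

lemma preimage_iso {s t : V'} (e : G' ≃g G) (h : IsRichInterior G (e s) (e t) C) :
    IsRichInterior G' s t (e ⁻¹' C) := by
  refine h.preimage (isContraction_of_iso e) (iso_preimage_singleton e s)
    (iso_preimage_singleton e t) fun v _ hv => absurd hv ?_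
  exact Set.not_nontrivial_iff.2 (Set.subsingleton_singleton.preimage e.injective)

end IsRichInterior

/-- Removing the nonadjacent vertices `s` and `t` from `G` leaves exactly three components
`C 0`, `C 1`, `C 2`, and each of them is a rich interior. -/
structure IsTripleCut (G : SimpleGraph V) (s t : V) (C : Fin 3 → Set V) : Prop where
  ne : s ≠ t
  not_adj : ¬G.Adj s t
  iUnion : ⋃ i, C i = {s, t}ᶜ
  disjoint : Pairwise fun i j => Disjoint (C i) (C j)
  rich : ∀ i, IsRichInterior G s t (C i)

namespace IsTripleCut

lemma symm {C : Fin 3 → Set V} (h : IsTripleCut G s t C) : IsTripleCut G t s C where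
  ne := h.ne.symm
  not_adj hts := h.not_adj hts.symm
  iUnion := by rw [h.iUnion, Set.pair_comm]
  disjoint := h.disjoint
  rich i := (h.rich i).symm

lemma subset_compl {C : Fin 3 → Set V} (h : IsTripleCut G s t C) (i : Fin 3) : C i ⊆ {s, t}ᶜ :=
  h.iUnion ▸ Set.subset_iUnion C i

lemma notMem {C : Fin 3 → Set V} (h : IsTripleCut G s t C) (i : Fin 3) : s ∉ C i :=
  fun hs => h.subset_compl i hs (Set.mem_insert _ _)

lemma mem_of_adj {C : Fin 3 → Set V} (h : IsTripleCut G s t C) {i : Fin 3} {v w : V}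
    (hv : v ∈ C i) (hw : w ∈ ({s, t}ᶜ : Set V)) (hvw : G.Adj v w) : w ∈ C i :=
  by_contra fun hwC => hw ((h.rich i).closed v hv w hvw hwC)

lemma subset_of_preconnected {C : Fin 3 → Set V} (h : IsTripleCut G s t C) {S : Set V}
    (hS : (G.induce S).Preconnected) (hst : S ⊆ {s, t}ᶜ) {i : Fin 3} (hi : (S ∩ C i).Nonempty) :
    S ⊆ C i :=
  subset_of_preconnected_of_forall_adj hS (fun _ hv _ hw hvw => h.mem_of_adj hv.2 (hst hw) hvw) hi

lemma preimage {π : V' → V} {s t : V'} {C : Fin 3 → Set V} (h : IsTripleCut G (π s) (π t) C)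
    (hπ : IsContraction G' G π) (hs : π ⁻¹' {π s} = {s}) (ht : π ⁻¹' {π t} = {t})
    (hrich : ∀ i, IsRichInterior G' s t (π ⁻¹' C i)) :
    IsTripleCut G' s t fun i => π ⁻¹' C i where
  ne hst := h.ne (congrArg π hst)
  not_adj hst := h.not_adj (hπ.adj s t hst h.ne)
  iUnion := by
    rw [← Set.preimage_iUnion, h.iUnion, Set.preimage_compl, Set.insert_eq, Set.preimage_union,
      hs, ht, Set.insert_eq]
  disjoint i j hij := (h.disjoint hij).preimage π
  rich := hrich

lemma preimage_iso {s t : V'} {C : Fin 3 → Set V} {e : G' ≃g G} (h : IsTripleCut G (e s) (e t) C) :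
    IsTripleCut G' s t fun i => e ⁻¹' C i :=
  h.preimage (isContraction_of_iso e) (iso_preimage_singleton e s) (iso_preimage_singleton e t)
    fun i => (h.rich i).preimage_iso e

end IsTripleCut

end TripleCuts

section DoubleSubdivision

variable {V : Type u} {G : SimpleGraph V} {p q r : V}

@[simp]
lemma doubleSubdivision_adj_inl_inl {a b : V} :
    (doubleSubdivision G p q).Adj (.inl a) (.inl b) ↔ G.Adj a b ∧ s(a, b) ≠ s(p, q) :=
  SimpleGraph.deleteEdges_adj

@[simp]
lemma doubleSubdivision_adj_inl_inr {a : V} {k : Fin 2} :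
    (doubleSubdivision G p q).Adj (.inl a) (.inr k) ↔ a ∈ s(p, q) :=
  Sym2.mem_iff.symm

@[simp]
lemma doubleSubdivision_adj_inr_inl {b : V} {k : Fin 2} :
    (doubleSubdivision G p q).Adj (.inr k) (.inl b) ↔ b ∈ s(p, q) :=
  Sym2.mem_iff.symm

@[simp]
lemma not_doubleSubdivision_adj_inr_inr {k l : Fin 2} :
    ¬(doubleSubdivision G p q).Adj (.inr k) (.inr l) :=
  id

lemma doubleSubdivision_congr {p' q' : V} (h : s(p, q) = s(p', q')) :
    doubleSubdivision G p q = doubleSubdivision G p' q' := by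
  ext (a | k) (b | l) <;> simp [h]

lemma adj_of_mem_of_mem (hpq : G.Adj p q) {a b : V} (ha : a ∈ s(p, q)) (hb : b ∈ s(p, q))
    (hab : a ≠ b) : G.Adj a b := by
  rwa [← SimpleGraph.mem_edgeSet, ← (Sym2.mem_and_mem_iff hab).1 ⟨ha, hb⟩]

lemma exists_mem_ne_ne (hpq : p ≠ q) {a b : V} (h : s(a, b) ≠ s(p, q)) :
    ∃ r ∈ s(p, q), a ≠ r ∧ b ≠ r := by
  simp only [ne_eq, Sym2.eq_iff] at h
  simp only [Sym2.mem_iff, exists_eq_or_imp, exists_eq_left]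
  grind

lemma isModelOn_inl : IsModelOn G {p, q}ᶜ (doubleSubdivision G p q) fun v => {.inl v} where
  connected v _ := connected_induce_singleton _ _
  disjoint v w hvw := by simpa using hvw
  touches v w hw hvw := by
    simp only [Set.mem_compl_iff, Set.mem_insert_iff, Set.mem_singleton_iff, not_or] at hw
    simp [touches_singleton, hvw, hw.1, hw.2]

/-- The map from a double subdivision back to `G` that sends both new vertices to `r`; it is a
contraction when `r` is an end of the subdivided edge. -/
def collapse (r : V) : V ⊕ Fin 2 → V :=
  Sum.elim id fun _ => r

lemma collapse_preimage_singleton {a : V} (ha : a ≠ r) : collapse r ⁻¹' {a} = {.inl a} := by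
  ext (b | k) <;> simp [collapse, ha.symm]

lemma collapse_preimage_compl_pair {a b : V} (ha : a ≠ r) (hb : b ≠ r) :
    collapse r ⁻¹' {a, b}ᶜ = {.inl a, .inl b}ᶜ := by
  rw [Set.preimage_compl, Set.insert_eq, Set.preimage_union, collapse_preimage_singleton ha,
    collapse_preimage_singleton hb, Set.insert_eq]

lemma touches_collapse_preimage {a : V} (ha : G.Adj r a) :
    Touches (doubleSubdivision G p q) (collapse r ⁻¹' {r}) (collapse r ⁻¹' {a}) := by
  by_cases hra : s(r, a) = s(p, q)
  · exact ⟨.inr 0, rfl, .inl a, rfl, by simp [← hra]⟩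
  · exact ⟨.inl r, rfl, .inl a, rfl, by simp [ha, hra]⟩

lemma isContraction_collapse (hpq : G.Adj p q) (hr : r ∈ s(p, q)) :
    IsContraction (doubleSubdivision G p q) G (collapse r) where
  connected v := by
    obtain rfl | hv := eq_or_ne v r
    · refine connected_induce_of_forall_adj (c := .inl v) rfl ?_
      rintro (a | k) ha hne
      · exact absurd (congrArg Sum.inl ha) hne
      · simpa using hr
    · rw [collapse_preimage_singleton hv]
      exact connected_induce_singleton _ _
  touches v w hvw := by
    obtain rfl | hv := eq_or_ne v r
    · exact touches_collapse_preimage hvw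
    obtain rfl | hw := eq_or_ne w r
    · exact (touches_collapse_preimage hvw.symm).symm
    rw [collapse_preimage_singleton hv, collapse_preimage_singleton hw, touches_singleton,
      doubleSubdivision_adj_inl_inl]
    refine ⟨hvw, fun h => ?_⟩
    rw [← h, Sym2.mem_iff] at hr
    exact hr.elim hv.symm hw.symm
  adj a b hab hne := by
    rcases a with a | k <;> rcases b with b | l
    · exact (doubleSubdivision_adj_inl_inl.1 hab).1
    · exact adj_of_mem_of_mem hpq (doubleSubdivision_adj_inl_inr.1 hab) hr hne
    · exact adj_of_mem_of_mem hpq hr (doubleSubdivision_adj_inr_inl.1 hab) hne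
    · exact absurd rfl hne

lemma hasDoubledPath_collapse_preimage {a b : V} (hra : s(p, q) = s(r, a)) (hrb : G.Adj r b)
    (hab : a ≠ b) :
    HasDoubledPath (doubleSubdivision G p q) (.inl a) (.inl b) (collapse r ⁻¹' {r}) := by
  rw [doubleSubdivision_congr hra]
  refine ⟨![{.inr 0}, {.inr 1}, {.inl r}],
    { connected := fun k => by fin_cases k <;> exact connected_induce_singleton _ _
      disjoint := fun k l hkl => by fin_cases k <;> fin_cases l <;> simp_all
      touches_left := fun k hk => by fin_cases k <;> simp_all [touches_singleton]
      touches_mid := fun k hk => by fin_cases k <;> simp_all [touches_singleton]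
      touches_right := ?_ }, fun k => by fin_cases k <;> simp [collapse]⟩
  simp [touches_singleton, hrb.symm, hrb.ne', hab.symm]

lemma IsRichInterior.preimage_collapse (hpq : G.Adj p q) (hr : r ∈ s(p, q)) {a b : V} {C : Set V}
    (hab : a ≠ b) (ha : a ≠ r) (hb : b ≠ r) (h : IsRichInterior G a b C) :
    IsRichInterior (doubleSubdivision G p q) (.inl a) (.inl b) (collapse r ⁻¹' C) := by
  refine h.preimage (isContraction_collapse hpq hr) (collapse_preimage_singleton ha)
    (collapse_preimage_singleton hb) ?_
  rintro v rfl hv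
  obtain rfl : v = r := by
    by_contra hvr
    simp [collapse_preimage_singleton hvr] at hv
  have hva : G.Adj v a := (touches_singleton.1 h.touches_left).symm
  have hvb : G.Adj v b := (touches_singleton.1 h.touches_right).symm
  obtain ⟨c, hc⟩ := Sym2.mem_iff_exists.1 hr
  have hvc : G.Adj v c := by rwa [← SimpleGraph.mem_edgeSet, ← hc]
  obtain rfl | rfl := h.closed v rfl c hvc hvc.ne'
  · exact .inl (hasDoubledPath_collapse_preimage hc hvb hab)
  · exact .inr (hasDoubledPath_collapse_preimage hc hva hab.symm)

lemma IsTripleCut.preimage_collapse (hpq : G.Adj p q) (hr : r ∈ s(p, q)) {a b : V}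
    {C : Fin 3 → Set V} (ha : a ≠ r) (hb : b ≠ r) (h : IsTripleCut G a b C) :
    IsTripleCut (doubleSubdivision G p q) (.inl a) (.inl b) fun i => collapse r ⁻¹' C i :=
  h.preimage (isContraction_collapse hpq hr) (collapse_preimage_singleton ha)
    (collapse_preimage_singleton hb) fun i => (h.rich i).preimage_collapse hpq hr h.ne ha hb

lemma connected_induce_insert_inr {S : Set V} (hS : (G.induce S).Connected) (hr : r ∈ s(p, q))
    (hrS : r ∈ S) (k : Fin 2) :
    ((doubleSubdivision G p q).induce (insert (.inr k) (Sum.inl '' S))).Connected := by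
  let B (v : V) : Set (V ⊕ Fin 2) := insert (.inl v) {x | x = .inr k ∧ v ∈ s(p, q)}
  have hB : ⋃ v ∈ S, B v = insert (.inr k) (Sum.inl '' S) := by
    ext (a | l)
    · simp [B]
    · simpa [B] using fun _ => ⟨r, hrS, Sym2.mem_iff.1 hr⟩
  rw [← hB]
  refine connected_induce_biUnion hS (fun v _ => ?_) fun v _ w _ hvw => ?_
  · refine connected_induce_of_forall_adj (Set.mem_insert _ _) ?_
    rintro _ (rfl | ⟨rfl, hv⟩) hne
    · exact absurd rfl hne
    · exact doubleSubdivision_adj_inl_inr.2 hv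
  · by_cases h : s(v, w) = s(p, q)
    · exact ⟨.inr k, by simp [B, ← h], .inl w, by simp [B], by simp [← h]⟩
    · exact ⟨.inl v, by simp [B], .inl w, by simp [B], by simp [h, hvw]⟩

end DoubleSubdivision

section NewTripleCut

variable {V : Type u} {G : SimpleGraph V} {p q : V}

lemma isRichInterior_singleton {s t v : V} (hs : G.Adj s v) (ht : G.Adj t v)
    (hclosed : ∀ w, G.Adj v w → w = s ∨ w = t) : IsRichInterior G s t {v} where
  connected := connected_induce_singleton G v
  touches_left := touches_singleton.2 hs
  touches_right := touches_singleton.2 ht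
  closed := by
    rintro _ rfl w hvw -
    exact hclosed w hvw
  doubled h := absurd h Set.not_nontrivial_singleton

lemma isRichInterior_image_inl (h : IsRichInterior G p q {p, q}ᶜ) :
    IsRichInterior (doubleSubdivision G p q) (.inl p) (.inl q) (Sum.inl '' {p, q}ᶜ) := by
  rw [Set.image_eq_iUnion]
  refine h.of_isModelOn isModelOn_inl rfl rfl ?_ fun v _ hv => absurd hv (by simp)
  rw [← Set.image_eq_iUnion]
  rintro _ ⟨a, ha, rfl⟩ (b | k) hab hb
  · simpa [or_iff_not_imp_left] using hb
  · exact absurd (Sym2.mem_iff.1 (doubleSubdivision_adj_inl_inr.1 hab)) ha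

/-- The bridge interiors at the pair of ends of a doubly subdivided edge `pq`: the old one and
those formed by the new vertices. -/
def newInterior (p q : V) : Option (Fin 2) → Set (V ⊕ Fin 2)
  | none => Sum.inl '' {p, q}ᶜ
  | some k => {.inr k}

lemma isTripleCut_newInterior (hpq : G.Adj p q) (h : IsRichInterior G p q {p, q}ᶜ)
    {ℓ : Fin 3 → Option (Fin 2)} (hℓ : ℓ.Injective) :
    IsTripleCut (doubleSubdivision G p q) (.inl p) (.inl q) fun i => newInterior p q (ℓ i) where
  ne := Sum.inl_injective.ne hpq.ne
  not_adj := by simp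
  iUnion := by
    have hsurj : ℓ.Surjective := ((Fintype.bijective_iff_injective_and_card ℓ).2 ⟨hℓ, rfl⟩).2
    rw [hsurj.iUnion_comp (newInterior p q)]
    ext (a | k) <;> simp [Set.iUnion_option, newInterior]
  disjoint i j hij := by
    have hne := hℓ.ne hij
    cases hi : ℓ i <;> cases hj : ℓ j <;> simp_all [newInterior]
  rich i := by
    cases ℓ i with
    | none => exact isRichInterior_image_inl h
    | some k =>
      refine isRichInterior_singleton (by simp) (by simp) ?_
      rintro (a | l) <;> simp

end NewTripleCut

section GeneralisedTriangle

variable {V : Type u} {G : SimpleGraph V} {p q s t : V}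

lemma IsRichInterior.connected_compl_singleton (h : IsRichInterior G s t {s, t}ᶜ) (hst : s ≠ t) :
    (G.induce {s}ᶜ).Connected := by
  have hcompl : ({s}ᶜ : Set V) = {t} ∪ {s, t}ᶜ := by grind
  rw [hcompl]
  exact h.touches_right.connected_union (connected_induce_singleton G t) h.connected

lemma hasDoubledPath_inl_inr (hpq : G.Adj p q) (h : IsRichInterior G p q {p, q}ᶜ) {k l : Fin 2}
    (hlk : l ≠ k) :
    HasDoubledPath (doubleSubdivision G p q) (.inl p) (.inr k) {.inl p, .inr k}ᶜ := by
  have hold := isRichInterior_image_inl h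
  refine ⟨![Sum.inl '' {p, q}ᶜ, {.inr l}, {.inl q}],
    { connected := ?_
      disjoint := fun i j hij => by fin_cases i <;> fin_cases j <;> simp_all
      touches_left := ?_
      touches_mid := ?_
      touches_right := by simp [touches_singleton] }, ?_⟩
  · simp [Fin.forall_fin_succ, hold.connected]
  · simpa [Fin.forall_fin_succ, touches_singleton] using hold.touches_left
  · simpa [Fin.forall_fin_succ, touches_singleton] using hold.touches_right.symm
  · intro i
    fin_cases i
    · rintro _ ⟨a, ha, rfl⟩
      simpa using fun h => ha (.inl h)
    · simpa using hlk
    · simpa using hpq.ne'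

lemma compl_pair_inl_inr {a : V} {k l : Fin 2} (hlk : l ≠ k) :
    ({.inl a, .inr k}ᶜ : Set (V ⊕ Fin 2)) = insert (.inr l) (Sum.inl '' {a}ᶜ) := by
  ext (b | m)
  · simp
  · simpa using (by lia : m ≠ k ↔ m = l)

lemma isRichInterior_compl_inl_inr (hpq : G.Adj p q) (h : IsRichInterior G p q {p, q}ᶜ)
    (k : Fin 2) :
    IsRichInterior (doubleSubdivision G p q) (.inl p) (.inr k) {.inl p, .inr k}ᶜ where
  connected := by
    obtain ⟨l, hlk⟩ := exists_ne k
    rw [compl_pair_inl_inr hlk]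
    exact connected_induce_insert_inr (h.connected_compl_singleton hpq.ne)
      (Sym2.mem_mk_right p q) hpq.ne' l
  touches_left := ⟨_, rfl, .inr (k + 1), by simp, by simp⟩
  touches_right := ⟨_, rfl, .inl q, by simp [hpq.ne'], by simp⟩
  closed a _ b _ hb := by simpa [or_iff_not_imp_left] using hb
  doubled _ :=
    have ⟨_, hlk⟩ := exists_ne k
    .inl (hasDoubledPath_inl_inr hpq h hlk)

lemma IsRichInterior.preimage_iso_compl {W : Type v} {G' : SimpleGraph W} (e : G' ≃g G) {s t : W}
    (h : IsRichInterior G (e s) (e t) {e s, e t}ᶜ) : IsRichInterior G' s t {s, t}ᶜ := by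
  have := h.preimage_iso e
  rwa [Set.preimage_compl, show e ⁻¹' {e s, e t} = {s, t} by ext; simp] at this

lemma isRichInterior_compl_of_iso_triangle (e : G ≃g (⊤ : SimpleGraph (Fin 3))) (hst : s ≠ t) :
    IsRichInterior G s t {s, t}ᶜ := by
  refine .preimage_iso_compl e ?_
  obtain ⟨k, hk⟩ : ∃ k, ({e s, e t}ᶜ : Set (Fin 3)) = {k} := by
    have (i j : Fin 3) (hij : i ≠ j) : ∃ k, ∀ l, (l ≠ i ∧ l ≠ j) ↔ l = k := by decide +revert
    simpa [Set.ext_iff] using this _ _ (e.injective.ne hst)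
  have hks : k ≠ e s ∧ k ≠ e t := by simpa using hk.superset (Set.mem_singleton k)
  rw [hk]
  refine isRichInterior_singleton hks.1.symm hks.2.symm fun w hkw => ?_
  by_contra! hw
  exact hkw (hk.subset (by simpa using hw)).symm

namespace IsGeneralisedTriangle

theorem isRichInterior_compl (hG : IsGeneralisedTriangle G) (hst : G.Adj s t) :
    IsRichInterior G s t {s, t}ᶜ := by
  induction hG with
  | triangle G e => exact isRichInterior_compl_of_iso_triangle e hst.ne
  | subdivide G G' p q _ hpq e ih =>
    refine .preimage_iso_compl e ?_
    replace hst := e.map_adj_iff.2 hst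
    generalize e s = a at hst; generalize e t = b at hst
    have inl_inr {a} {k : Fin 2} (ha : a ∈ s(p, q)) :
        IsRichInterior (doubleSubdivision G p q) (.inl a) (.inr k) {.inl a, .inr k}ᶜ := by
      obtain ⟨c, hc⟩ := Sym2.mem_iff_exists.1 ha
      have hac : G.Adj a c := by rwa [← SimpleGraph.mem_edgeSet, ← hc]
      rw [doubleSubdivision_congr hc]
      exact isRichInterior_compl_inl_inr hac (ih hac) k
    rcases a with a | k <;> rcases b with b | l
    · rw [doubleSubdivision_adj_inl_inl] at hst
      obtain ⟨r, hr, hra, hrb⟩ := exists_mem_ne_ne hpq.ne hst.2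
      rw [← collapse_preimage_compl_pair hra hrb]
      exact (ih hst.1).preimage_collapse hpq hr hst.1.ne hra hrb
    · exact inl_inr (doubleSubdivision_adj_inl_inr.1 hst)
    · rw [Set.pair_comm]
      exact (inl_inr (doubleSubdivision_adj_inr_inl.1 hst)).symm
    · exact absurd hst not_doubleSubdivision_adj_inr_inr

lemma exists_adj (hG : IsGeneralisedTriangle G) (s : V) : ∃ t, G.Adj s t := by
  induction hG with
  | triangle G e =>
    obtain ⟨k, hk⟩ := exists_ne (e s)
    exact ⟨e.symm k, e.map_adj_iff.1 (by simpa using hk.symm)⟩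
  | subdivide G G' p q _ _ e ih =>
    suffices h : ∃ b, (doubleSubdivision G p q).Adj (e s) b by
      obtain ⟨b, hb⟩ := h
      exact ⟨e.symm b, e.map_adj_iff.1 (by simpa using hb)⟩
    obtain a | k := e s
    · obtain ⟨b, hab⟩ := ih a
      by_cases h : s(a, b) = s(p, q)
      · exact ⟨.inr 0, by simp [← h]⟩
      · exact ⟨.inl b, by simp [hab, h]⟩
    · exact ⟨.inl p, by simp⟩

lemma connected_compl_singleton (hG : IsGeneralisedTriangle G) (s : V) :
    (G.induce {s}ᶜ).Connected :=
  have ⟨_, hst⟩ := hG.exists_adj s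
  (hG.isRichInterior_compl hst).connected_compl_singleton hst.ne

lemma preconnected (hG : IsGeneralisedTriangle G) : G.Preconnected := by
  intro s
  obtain ⟨t, hst⟩ := hG.exists_adj s
  have htouch : Touches G {s} {s}ᶜ := ⟨s, rfl, t, hst.ne', hst⟩
  have huniv := htouch.connected_union (connected_induce_singleton G s)
    (hG.connected_compl_singleton s)
  rw [Set.union_compl_self, (SimpleGraph.induceUnivIso G).connected_iff] at huniv
  exact huniv.preconnected s

lemma connected_compl_pair_inl_inr (hG : IsGeneralisedTriangle G) (hpq : G.Adj p q) (a : V)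
    (k : Fin 2) :
    ((doubleSubdivision G p q).induce {.inl a, .inr k}ᶜ).Connected := by
  obtain ⟨r, hr, hra⟩ : ∃ r ∈ s(p, q), r ≠ a := by
    obtain rfl | hpa := eq_or_ne p a
    · exact ⟨q, Sym2.mem_mk_right p q, hpq.ne'⟩
    · exact ⟨p, Sym2.mem_mk_left p q, hpa⟩
  rw [compl_pair_inl_inr (k := k) (l := k + 1) (by lia)]
  exact connected_induce_insert_inr (hG.connected_compl_singleton a) hr hra (k + 1)

lemma connected_compl_pair_inr_inr (hG : IsGeneralisedTriangle G) (hpq : G.Adj p q) {k l : Fin 2}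
    (hkl : k ≠ l) :
    ((doubleSubdivision G p q).induce {.inr k, .inr l}ᶜ).Connected := by
  have hcompl : ({.inr k, .inr l}ᶜ : Set (V ⊕ Fin 2)) =
      {.inl q} ∪ ({.inl p} ∪ Sum.inl '' {p, q}ᶜ) := by
    ext (a | m)
    · simpa using (by tauto : a = p ∨ a = q ∨ ¬a = p ∧ ¬a = q)
    · simpa using (by lia : ¬m = k → m = l)
  have hold := isRichInterior_image_inl (hG.isRichInterior_compl hpq)
  obtain ⟨_, rfl, b, hb, hqb⟩ := hold.touches_right
  rw [hcompl]
  refine Touches.connected_union ⟨_, rfl, b, .inr hb, hqb⟩ (connected_induce_singleton _ _) ?_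
  exact hold.touches_left.connected_union (connected_induce_singleton _ _) hold.connected

theorem connected_compl_pair_or_isTripleCut (hG : IsGeneralisedTriangle G) (hst : s ≠ t) :
    (G.induce {s, t}ᶜ).Connected ∨ ∃ C, IsTripleCut G s t C := by
  induction hG with
  | triangle G e => exact .inl (isRichInterior_compl_of_iso_triangle e hst).connected
  | subdivide G G' p q hG hpq e ih =>
    suffices h : ((doubleSubdivision G p q).induce {e s, e t}ᶜ).Connected ∨
        ∃ C, IsTripleCut (doubleSubdivision G p q) (e s) (e t) C by
      refine h.imp (fun h => ?_) fun ⟨C, hC⟩ => ⟨_, hC.preimage_iso⟩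
      have := (isContraction_of_iso e).connected_preimage h
      rwa [Set.preimage_compl, show e ⁻¹' {e s, e t} = {s, t} by ext; simp] at this
    have hab := e.injective.ne hst
    generalize e s = a at hab ⊢
    generalize e t = b at hab ⊢
    rcases a with a | k <;> rcases b with b | l
    · by_cases h : s(a, b) = s(p, q)
      · refine .inr ?_
        have : G.Adj a b := by rwa [← SimpleGraph.mem_edgeSet, h]
        rw [← doubleSubdivision_congr h]
        exact ⟨_, isTripleCut_newInterior this (hG.isRichInterior_compl this)
          (finSuccEquiv 2).injective⟩
      · obtain ⟨r, hr, har, hbr⟩ := exists_mem_ne_ne hpq.ne h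
        refine (ih (by simpa using hab)).imp (fun h => ?_)
          fun ⟨C, hC⟩ => ⟨_, hC.preimage_collapse hpq hr har hbr⟩
        rw [← collapse_preimage_compl_pair har hbr]
        exact (isContraction_collapse hpq hr).connected_preimage h
    · exact .inl (connected_compl_pair_inl_inr hG hpq a l)
    · rw [Set.pair_comm]
      exact .inl (connected_compl_pair_inl_inr hG hpq b k)
    · exact .inl (connected_compl_pair_inr_inr hG hpq (by simpa using hab))

end IsGeneralisedTriangle

end GeneralisedTriangle

section EdgeTriples

variable {V : Type u} {G : SimpleGraph V} {p q : V}

/-- `x 0 y 0`, `x 1 y 1`, `x 2 y 2` are three distinct edges of `G` that join the disjoint connected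
sets `X` and `Y`. -/
structure IsEdgeTriple (G : SimpleGraph V) (X Y : Set V) (x y : Fin 3 → V) : Prop where
  connected_left : (G.induce X).Connected
  connected_right : (G.induce Y).Connected
  disjoint : Disjoint X Y
  mem_left : ∀ i, x i ∈ X
  mem_right : ∀ i, y i ∈ Y
  adj : ∀ i, G.Adj (x i) (y i)
  injective : Function.Injective fun i => (x i, y i)

/-- A triple cut with one vertex in `X` and one in `Y` places the edges `x i y i` in three distinct
bridges. -/
def IsSeparated (G : SimpleGraph V) (X Y : Set V) (x y : Fin 3 → V) : Prop :=
  ∃ s ∈ X, ∃ t ∈ Y, ∃ C, IsTripleCut G s t C ∧ ∀ i, x i ∈ insert s (C i) ∧ y i ∈ insert t (C i)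

lemma IsEdgeTriple.symm {X Y : Set V} {x y : Fin 3 → V} (h : IsEdgeTriple G X Y x y) :
    IsEdgeTriple G Y X y x where
  connected_left := h.connected_right
  connected_right := h.connected_left
  disjoint := h.disjoint.symm
  mem_left := h.mem_right
  mem_right := h.mem_left
  adj i := (h.adj i).symm
  injective i j hij := h.injective (by simpa [and_comm] using hij)

lemma IsEdgeTriple.map_iso {V' : Type v} {G' : SimpleGraph V'} (e : G' ≃g G) {X Y : Set V'}
    {x y : Fin 3 → V'} (h : IsEdgeTriple G' X Y x y) :
    IsEdgeTriple G (e.symm ⁻¹' X) (e.symm ⁻¹' Y) (e ∘ x) (e ∘ y) where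
  connected_left := (isContraction_of_iso e.symm).connected_preimage h.connected_left
  connected_right := (isContraction_of_iso e.symm).connected_preimage h.connected_right
  disjoint := h.disjoint.preimage _
  mem_left i := by simpa using h.mem_left i
  mem_right i := by simpa using h.mem_right i
  adj i := e.map_adj_iff.2 (h.adj i)
  injective := (e.injective.prodMap e.injective).comp h.injective

lemma IsSeparated.of_iso {V' : Type v} {G' : SimpleGraph V'} (e : G' ≃g G) {X Y : Set V'}
    {x y : Fin 3 → V'} (h : IsSeparated G (e.symm ⁻¹' X) (e.symm ⁻¹' Y) (e ∘ x) (e ∘ y)) :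
    IsSeparated G' X Y x y := by
  obtain ⟨s, hs, t, ht, C, hC, hxy⟩ := h
  obtain ⟨s, rfl⟩ := e.surjective s
  obtain ⟨t, rfl⟩ := e.surjective t
  exact ⟨s, by simpa using hs, t, by simpa using ht, _, hC.preimage_iso, by simpa using hxy⟩

lemma not_isEdgeTriple_of_iso_triangle (e : G ≃g (⊤ : SimpleGraph (Fin 3))) {X Y : Set V}
    {x y : Fin 3 → V} : ¬IsEdgeTriple G X Y x y := by
  have pigeonhole : ∀ x y : Fin 3 → Fin 3, (∀ i j, x i ≠ y j) →
      ∃ i j, i ≠ j ∧ x i = x j ∧ y i = y j := by decide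
  intro h
  obtain ⟨i, j, hij, hx, hy⟩ := pigeonhole (e ∘ x) (e ∘ y) fun i j =>
    e.injective.ne (h.disjoint.ne_of_mem (h.mem_left i) (h.mem_right j))
  exact hij (h.injective (Prod.ext (e.injective hx) (e.injective hy)))

lemma connected_induce_preimage_inl (hpq : G.Adj p q) {X : Set (V ⊕ Fin 2)}
    (hX : ((doubleSubdivision G p q).induce X).Connected) (hne : (Sum.inl ⁻¹' X).Nonempty) :
    (G.induce (Sum.inl ⁻¹' X)).Connected := by
  refine connected_induce_of_forall_subset hne fun P hP ⟨a, haX, haP⟩ => ?_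
  let Q : Set (V ⊕ Fin 2) :=
    Sum.elim (· ∈ P) fun _ => ∃ r ∈ s(p, q), .inl r ∈ X ∧ r ∈ P
  suffices h : X ⊆ Q from fun b hb => h hb
  refine subset_of_preconnected_of_forall_adj hX.preconnected ?_ ⟨.inl a, haX, haP⟩
  rintro (v | k) ⟨hvX, hvQ⟩ (w | l) hwX hvw
  · exact hP v ⟨hvX, hvQ⟩ w hwX (doubleSubdivision_adj_inl_inl.1 hvw).1
  · exact ⟨v, doubleSubdivision_adj_inl_inr.1 hvw, hvX, hvQ⟩
  · obtain ⟨r, hr, hrX, hrP⟩ := hvQ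
    obtain rfl | hrw := eq_or_ne r w
    · exact hrP
    · exact hP r ⟨hrX, hrP⟩ w hwX
        (adj_of_mem_of_mem hpq hr (doubleSubdivision_adj_inr_inl.1 hvw) hrw)
  · exact absurd hvw not_doubleSubdivision_adj_inr_inr

lemma IsEdgeTriple.exists_inl_mem {X Y : Set (V ⊕ Fin 2)} {x y : Fin 3 → V ⊕ Fin 2}
    (h : IsEdgeTriple (doubleSubdivision G p q) X Y x y) {k : Fin 2} (hk : .inr k ∈ Y) :
    ∃ r ∈ s(p, q), .inl r ∈ Y := by
  by_cases hY : Y = {.inr k}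
  · have hy i : y i = .inr k := by simpa [hY] using h.mem_right i
    have hx i : x i = .inl p ∨ x i = .inl q := by
      have hadj := h.adj i
      cases hxi : x i <;> simp_all
    have hinj : x.Injective := fun i j hij => h.injective (Prod.ext hij ((hy i).trans (hy j).symm))
    have h01 : x 0 ≠ x 1 := hinj.ne (by decide)
    have h02 : x 0 ≠ x 2 := hinj.ne (by decide)
    have h12 : x 1 ≠ x 2 := hinj.ne (by decide)
    grind
  · obtain ⟨r | l, hr, hadj⟩ := exists_adj_of_connected_induce h.connected_right hk hY
    · exact ⟨r, doubleSubdivision_adj_inr_inl.1 hadj, hr⟩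
    · exact absurd hadj not_doubleSubdivision_adj_inr_inr

/-- The edge `xy` of the double subdivision of `G` at `pq` arises from the edge `ab` of `G`: it is
`ab` itself, labelled `none`, or `ab` is `pq` and `xy` is incident with the new vertex in the
label. -/
inductive IsLift (p q a b : V) : Option (Fin 2) → V ⊕ Fin 2 → V ⊕ Fin 2 → Prop
  | old (h : s(a, b) ≠ s(p, q)) : IsLift p q a b none (.inl a) (.inl b)
  | left (k : Fin 2) (h : s(a, b) = s(p, q)) : IsLift p q a b (some k) (.inr k) (.inl b)
  | right (k : Fin 2) (h : s(a, b) = s(p, q)) : IsLift p q a b (some k) (.inl a) (.inr k)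

/-- The edges `x i y i` of the double subdivision arise, with labels `ℓ i`, from edges `a i b i` of
`G` that join `X` to `Y`. -/
structure IsLiftTriple (p q : V) (X Y : Set (V ⊕ Fin 2)) (x y : Fin 3 → V ⊕ Fin 2)
    (a b : Fin 3 → V) (ℓ : Fin 3 → Option (Fin 2)) : Prop where
  mem_left : ∀ i, .inl (a i) ∈ X
  mem_right : ∀ i, .inl (b i) ∈ Y
  isLift : ∀ i, IsLift p q (a i) (b i) (ℓ i) (x i) (y i)

lemma IsLift.eq_none_iff {a b : V} {ℓ : Option (Fin 2)} {x y : V ⊕ Fin 2}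
    (h : IsLift p q a b ℓ x y) : ℓ = none ↔ s(a, b) ≠ s(p, q) := by
  cases h <;> simp_all

lemma IsLift.eq_or_eq {a b : V} {ℓ : Option (Fin 2)} {x y x' y' : V ⊕ Fin 2}
    (h : IsLift p q a b ℓ x y) (h' : IsLift p q a b ℓ x' y') :
    x = x' ∧ y = y' ∨ x = y' ∨ y = x' := by
  cases h <;> cases h' <;> simp

lemma IsLift.adj (hpq : G.Adj p q) {a b : V} {ℓ : Option (Fin 2)} {x y : V ⊕ Fin 2}
    (h : IsLift p q a b ℓ x y) (hxy : (doubleSubdivision G p q).Adj x y) : G.Adj a b := by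
  cases h with
  | old => exact (doubleSubdivision_adj_inl_inl.1 hxy).1
  | left _ h | right _ h => rwa [← SimpleGraph.mem_edgeSet, h]

lemma IsLift.mem_newInterior {a b c d : V} {ℓ : Option (Fin 2)} {x y : V ⊕ Fin 2}
    (h : IsLift p q a b ℓ x y) (hcd : s(c, d) = s(p, q)) (had : a ≠ d) (hbc : b ≠ c) :
    x ∈ insert (.inl c) (newInterior c d ℓ) ∧ y ∈ insert (.inl d) (newInterior c d ℓ) := by
  have eq_of_eq (hab : s(a, b) = s(p, q)) : a = c ∧ b = d :=
    (Sym2.eq_iff.1 (hab.trans hcd.symm)).resolve_right fun h => had h.1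
  cases h with
  | old => simpa [newInterior, had, hbc] using ⟨em _, em _⟩
  | left k hab => simp [newInterior, eq_of_eq hab]
  | right k hab => simp [newInterior, eq_of_eq hab]

lemma IsLift.mem_collapse_preimage {a b r s t : V} {C : Set V} {ℓ : Option (Fin 2)}
    {x y : V ⊕ Fin 2} (h : IsLift p q a b ℓ x y) (hr : r ∈ s(p, q)) (hsr : s ≠ r) (htr : t ≠ r)
    (ha : a ∈ insert s C) (hb : b ∈ insert t C) :
    x ∈ insert (.inl s) (collapse r ⁻¹' C) ∧ y ∈ insert (.inl t) (collapse r ⁻¹' C) := by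
  have mem_of_eq (hab : s(a, b) = s(p, q)) : r ∈ C := by
    obtain rfl | rfl := Sym2.mem_iff.1 (hab ▸ hr)
    · exact ha.resolve_left hsr.symm
    · exact hb.resolve_left htr.symm
  cases h with
  | old => simpa [collapse] using ⟨ha, hb⟩
  | left k hab => simpa [collapse, mem_of_eq hab] using hb
  | right k hab => simpa [collapse, mem_of_eq hab] using ha

lemma IsEdgeTriple.exists_isLift {X Y : Set (V ⊕ Fin 2)} {x y : Fin 3 → V ⊕ Fin 2}
    (h : IsEdgeTriple (doubleSubdivision G p q) X Y x y) (i : Fin 3) :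
    ∃ a b ℓ, .inl a ∈ X ∧ .inl b ∈ Y ∧ IsLift p q a b ℓ (x i) (y i) := by
  have hadj := h.adj i
  have hX := h.mem_left i
  have hY := h.mem_right i
  generalize x i = v at hadj hX
  generalize y i = w at hadj hY
  have pair_eq {a b : V} (ha : .inl a ∈ X) (hb : .inl b ∈ Y) (hap : a ∈ s(p, q))
      (hbp : b ∈ s(p, q)) : s(a, b) = s(p, q) :=
    ((Sym2.mem_and_mem_iff fun hab => h.disjoint.ne_of_mem ha hb (by rw [hab])).1
      ⟨hap, hbp⟩).symm
  rcases v with a | k <;> rcases w with b | l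
  · exact ⟨a, b, none, hX, hY, .old (doubleSubdivision_adj_inl_inl.1 hadj).2⟩
  · obtain ⟨b, hb, hbY⟩ := h.exists_inl_mem hY
    exact ⟨a, b, some l, hX, hbY,
      .right l (pair_eq hX hbY (doubleSubdivision_adj_inl_inr.1 hadj) hb)⟩
  · obtain ⟨a, ha, haX⟩ := h.symm.exists_inl_mem hX
    exact ⟨a, b, some k, haX, hY,
      .left k (pair_eq haX hY ha (doubleSubdivision_adj_inr_inl.1 hadj))⟩
  · exact absurd hadj not_doubleSubdivision_adj_inr_inr

namespace IsLiftTriple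

variable {X Y : Set (V ⊕ Fin 2)} {x y : Fin 3 → V ⊕ Fin 2} {a b : Fin 3 → V}
  {ℓ : Fin 3 → Option (Fin 2)}

lemma ne (hl : IsLiftTriple p q X Y x y a b ℓ) (hXY : Disjoint X Y) (i j : Fin 3) : a i ≠ b j :=
  fun hab => hXY.ne_of_mem (hl.mem_left i) (hl.mem_right j) (by rw [hab])

lemma eq_of_label_ne_none (hl : IsLiftTriple p q X Y x y a b ℓ) (hXY : Disjoint X Y) {i j : Fin 3}
    (hi : ℓ i ≠ none) (hj : ℓ j ≠ none) : a i = a j ∧ b i = b j := by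
  rw [Ne, (hl.isLift _).eq_none_iff, not_not] at hi hj
  have hij : s(a i, b i) = s(a j, b j) := hi.trans hj.symm
  have := hl.ne hXY i j
  simp_all

lemma eq_of_eq (hl : IsLiftTriple p q X Y x y a b ℓ)
    (h : IsEdgeTriple (doubleSubdivision G p q) X Y x y) {i j : Fin 3} (ha : a i = a j)
    (hb : b i = b j) (hℓ : ℓ i = ℓ j) : i = j := by
  have hj := hl.isLift j
  rw [← ha, ← hb, ← hℓ] at hj
  obtain ⟨hx, hy⟩ | hxy | hxy := (hl.isLift i).eq_or_eq hj
  · exact h.injective (Prod.ext hx hy)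
  · exact absurd hxy (h.disjoint.ne_of_mem (h.mem_left i) (h.mem_right j))
  · exact absurd hxy.symm (h.disjoint.ne_of_mem (h.mem_left j) (h.mem_right i))

lemma injective_label_or (hl : IsLiftTriple p q X Y x y a b ℓ)
    (h : IsEdgeTriple (doubleSubdivision G p q) X Y x y) :
    ℓ.Injective ∨ Function.Injective fun i => (a i, b i) := by
  by_contra! hnot
  simp only [Function.Injective, not_forall, Prod.mk.injEq] at hnot
  obtain ⟨⟨i, j, hℓij, hij⟩, m, n, ⟨ha, hb⟩, hmn⟩ := hnot
  have hℓmn : ℓ m ≠ ℓ n := fun hℓ => hmn (hl.eq_of_eq h ha hb hℓ)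
  have hmn_none : ℓ m = none ↔ ℓ n = none := by
    rw [(hl.isLift m).eq_none_iff, (hl.isLift n).eq_none_iff, ha, hb]
  have hi : ℓ i = none := by
    by_contra hi
    obtain ⟨hai, hbi⟩ := hl.eq_of_label_ne_none h.disjoint hi (hℓij ▸ hi)
    exact hij (hl.eq_of_eq h hai hbi hℓij)
  grind

lemma isSeparated_of_injective_label (hl : IsLiftTriple p q X Y x y a b ℓ)
    (h : IsEdgeTriple (doubleSubdivision G p q) X Y x y) (hG : IsGeneralisedTriangle G)
    (hpq : G.Adj p q) (hℓ : ℓ.Injective) :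
    IsSeparated (doubleSubdivision G p q) X Y x y := by
  obtain ⟨i, hi⟩ : ∃ i, ℓ i = some 0 :=
    ((Fintype.bijective_iff_injective_and_card ℓ).2 ⟨hℓ, rfl⟩).2 _
  have hipq : s(a i, b i) = s(p, q) := by
    by_contra hne
    simp [(hl.isLift i).eq_none_iff.2 hne] at hi
  have hadj : G.Adj (a i) (b i) := by rwa [← SimpleGraph.mem_edgeSet, hipq]
  refine ⟨.inl (a i), hl.mem_left i, .inl (b i), hl.mem_right i,
    fun j => newInterior (a i) (b i) (ℓ j), ?_, fun j => ?_⟩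
  · rw [← doubleSubdivision_congr hipq]
    exact isTripleCut_newInterior hadj (hG.isRichInterior_compl hadj) hℓ
  · exact (hl.isLift j).mem_newInterior hipq (hl.ne h.disjoint j i) (hl.ne h.disjoint i j).symm

lemma isSeparated_of_injective_edge (hl : IsLiftTriple p q X Y x y a b ℓ)
    (h : IsEdgeTriple (doubleSubdivision G p q) X Y x y) (hpq : G.Adj p q)
    (hab : Function.Injective fun i => (a i, b i))
    (ih : IsEdgeTriple G (Sum.inl ⁻¹' X) (Sum.inl ⁻¹' Y) a b →
      IsSeparated G (Sum.inl ⁻¹' X) (Sum.inl ⁻¹' Y) a b) :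
    IsSeparated (doubleSubdivision G p q) X Y x y := by
  obtain ⟨s, hs, t, ht, C, hC, habC⟩ := ih
    { connected_left := connected_induce_preimage_inl hpq h.connected_left ⟨_, hl.mem_left 0⟩
      connected_right := connected_induce_preimage_inl hpq h.connected_right ⟨_, hl.mem_right 0⟩
      disjoint := h.disjoint.preimage _
      mem_left := hl.mem_left
      mem_right := hl.mem_right
      adj i := (hl.isLift i).adj hpq (h.adj i)
      injective := hab }
  have hst : s(s, t) ≠ s(p, q) := fun hst =>
    hC.not_adj (by rwa [← SimpleGraph.mem_edgeSet, hst])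
  obtain ⟨r, hr, hsr, htr⟩ := exists_mem_ne_ne hpq.ne hst
  refine ⟨.inl s, hs, .inl t, ht, _, hC.preimage_collapse hpq hr hsr htr, fun i => ?_⟩
  exact (hl.isLift i).mem_collapse_preimage hr hsr htr (habC i).1 (habC i).2

end IsLiftTriple

theorem IsGeneralisedTriangle.isSeparated (hG : IsGeneralisedTriangle G) {X Y : Set V}
    {x y : Fin 3 → V} (h : IsEdgeTriple G X Y x y) : IsSeparated G X Y x y := by
  induction hG with
  | triangle G e => exact absurd h (not_isEdgeTriple_of_iso_triangle e)
  | subdivide G G' p q hG hpq e ih =>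
    replace h := h.map_iso e
    refine .of_iso e ?_
    choose a b ℓ ha hb hlift using h.exists_isLift
    have hl : IsLiftTriple p q _ _ _ _ a b ℓ := ⟨ha, hb, hlift⟩
    exact (hl.injective_label_or h).elim (hl.isSeparated_of_injective_label h hG hpq)
      fun hab => hl.isSeparated_of_injective_edge h hpq hab ih

end EdgeTriples

section Minors

open scoped SimpleGraph

variable {V : Type u} {W : Type v} {W' : Type*} {G : SimpleGraph V} {H : SimpleGraph W}
  {H' : SimpleGraph W'}

lemma isMinor_iff : IsMinor H G ↔ ∃ B, IsModelOn H Set.univ G B := by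
  refine exists_congr fun B => ⟨fun ⟨hconn, hdisj, hadj⟩ => ?_, fun hB => ?_⟩
  · exact ⟨fun v _ => hconn v, hdisj, fun v w _ => hadj v w⟩
  · exact ⟨fun v => hB.connected v trivial, hB.disjoint, fun v w => hB.touches v w trivial⟩

lemma IsMinor.of_isContained (h : IsMinor H' G) (hH : H ⊑ H') : IsMinor H G := by
  obtain ⟨B, hconn, hdisj, hadj⟩ := h
  obtain ⟨f⟩ := hH
  exact ⟨fun v => B (f v), fun v => hconn _, fun v w hvw => hdisj _ _ (f.injective.ne hvw),
    fun v w hvw => hadj _ _ (f.toHom.map_adj hvw)⟩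

lemma isMinor_fromRel {r : W → W → Prop} {B : W → Set V} (hconn : ∀ w, (G.induce (B w)).Connected)
    (hdisj : Pairwise fun v w => Disjoint (B v) (B w))
    (htouch : ∀ v w, r v w → Touches G (B v) (B w)) : IsMinor (.fromRel r) G :=
  ⟨B, hconn, hdisj, fun v w hvw => hvw.2.elim (htouch v w) fun h => (htouch w v h).symm⟩

/-- The graph formed by three paths of length three with common ends `inl 0` and `inl 1`; the
inner vertex of the `i`-th path next to `inl k` is `inr (i, k)`. -/
def thetaGraph : SimpleGraph (Fin 2 ⊕ Fin 3 × Fin 2) :=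
  .fromRel fun
    | .inl k, .inr (_, l) => k = l
    | .inr (i, k), .inr (j, l) => i = j ∧ k ≠ l
    | _, _ => False

/-- The graph `K₂,₃` with, for each `i`, the edge from `inl (ε i)` to the `i`-th vertex of the
larger part doubly subdivided: `inr (i, 2)` is that vertex, `inr (i, 0)` and `inr (i, 1)` are the
new ones. -/
def doubledK23 (ε : Fin 3 → Fin 2) : SimpleGraph (Fin 2 ⊕ Fin 3 × Fin 3) :=
  .fromRel fun
    | .inl k, .inr (i, l) => k = ε i ↔ l ≠ 2
    | .inr (i, k), .inr (j, l) => i = j ∧ k ≠ 2 ∧ l = 2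
    | _, _ => False

lemma thetaGraph_isContained_doubledK23 (ε : Fin 3 → Fin 2) : thetaGraph ⊑ doubledK23 ε := by
  let f : Fin 2 ⊕ Fin 3 × Fin 2 → Fin 2 ⊕ Fin 3 × Fin 3 :=
    Sum.map id fun (i, k) => (i, if k = ε i then 0 else 2)
  have hf : f.Injective := by
    rintro (k | ⟨i, k⟩) (l | ⟨j, l⟩) <;> grind
  refine ⟨⟨f, fun {v w} h => ?_⟩, hf⟩
  rcases v with k | ⟨i, k⟩ <;> rcases w with l | ⟨j, l⟩ <;>
    grind [thetaGraph, doubledK23, SimpleGraph.fromRel_adj]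

/-- The isomorphism induced by the permutation `σ` of the larger part of `K₂,₃` and the shift by
`k` of its smaller part. -/
def doubledK23Relabel {δ ε : Fin 3 → Fin 2} (σ : Equiv.Perm (Fin 3)) (k : Fin 2)
    (h : ∀ i, ε (σ i) = k + δ i) : doubledK23 δ ≃g doubledK23 ε where
  toEquiv := (Equiv.addLeft k).sumCongr (σ.prodCongr (Equiv.refl _))
  map_rel_iff' {a b} := by
    rcases a with a | ⟨i, a⟩ <;> rcases b with b | ⟨j, b⟩ <;> simp [doubledK23, h]

/-- The graph `K₂,₃` after doubly subdividing, for `i = 0, 1, 2` in turn, the edge from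
`inl (ε i)` to `inr i`. The choices `ε = ![0, 0, 0]` and `ε = ![0, 0, 1]` give `H1` and `H2`. -/
def subdividedK23 (ε : Fin 3 → Fin 2) :
    SimpleGraph ((((Fin 2 ⊕ Fin 3) ⊕ Fin 2) ⊕ Fin 2) ⊕ Fin 2) :=
  doubleSubdivision
    (doubleSubdivision
      (doubleSubdivision K23 (.inl (ε 0)) (.inr 0))
      (old1 (.inl (ε 1))) (old1 (.inr 1)))
    (old2 (.inl (ε 2))) (old2 (.inr 2))

/-- The vertex of `doubledK23 ε` corresponding to a vertex of `subdividedK23 ε`: both kinds of new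
vertices and the old vertex `i` are collected in the fibre of `i`. -/
def slot : (((Fin 2 ⊕ Fin 3) ⊕ Fin 2) ⊕ Fin 2) ⊕ Fin 2 → Fin 2 ⊕ Fin 3 × Fin 3
  | .inl (.inl (.inl (.inl k))) => .inl k
  | .inl (.inl (.inl (.inr i))) => .inr (i, 2)
  | .inl (.inl (.inr k)) => .inr (0, k.castSucc)
  | .inl (.inr k) => .inr (1, k.castSucc)
  | .inr k => .inr (2, k.castSucc)

lemma slot_bijective : slot.Bijective := by
  decide

lemma castSucc_ne_two : ∀ k : Fin 2, k.castSucc ≠ 2 := by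
  decide

/-- The iterated double subdivision `subdividedK23 ε` is the graph `doubledK23 ε`. -/
noncomputable def subdividedK23Iso (ε : Fin 3 → Fin 2) : subdividedK23 ε ≃g doubledK23 ε where
  toEquiv := .ofBijective slot slot_bijective
  map_rel_iff' {v w} := by
    rcases v with ((((k | i) | k) | k) | k) <;> rcases w with ((((l | j) | l) | l) | l) <;>
      (try fin_cases i) <;> (try fin_cases j) <;>
      simp [subdividedK23, slot, doubledK23, doubleSubdivision, castSucc_ne_two,
        (castSucc_ne_two _).symm]

lemma H1_isContained_or_H2_isContained (ε : Fin 3 → Fin 2) :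
    H1 ⊑ doubledK23 ε ∨ H2 ⊑ doubledK23 ε := by
  have hσ : ∃ σ : Equiv.Perm (Fin 3), ∃ k : Fin 2,
      (∀ i, ε (σ i) = k + ![0, 0, 0] i) ∨ (∀ i, ε (σ i) = k + ![0, 0, 1] i) := by
    decide +revert
  obtain ⟨σ, k, h | h⟩ := hσ
  · exact .inl (SimpleGraph.Iso.isContained
      ((subdividedK23Iso ![0, 0, 0]).trans (doubledK23Relabel σ k h)))
  · exact .inr (SimpleGraph.Iso.isContained
      ((subdividedK23Iso ![0, 0, 1]).trans (doubledK23Relabel σ k h)))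

end Minors

section NontrivialTripleCuts

variable {V : Type u} {G : SimpleGraph V} {s t : V} {C : Fin 3 → Set V}

lemma IsTripleCut.isMinor_doubledK23 (h : IsTripleCut G s t C) (hC : ∀ i, (C i).Nontrivial) :
    ∃ ε, IsMinor (doubledK23 ε) G := by
  have hpath (i) : ∃ k, HasDoubledPath G (![s, t] k) (![s, t] (k + 1)) (C i) :=
    ((h.rich i).doubled (hC i)).elim (fun hst => ⟨0, hst⟩) fun hts => ⟨1, hts⟩
  choose ε B hB hBC using hpath
  have root_notMem (k i) : ![s, t] k ∉ C i := by
    fin_cases k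
    exacts [h.notMem i, h.symm.notMem i]
  have root_ne {k l} (hkl : k ≠ l) : ![s, t] k ≠ ![s, t] l := by
    have := h.ne
    fin_cases k <;> fin_cases l <;> simp_all [eq_comm]
  refine ⟨ε, isMinor_fromRel
    (B := Sum.elim (fun k => {![s, t] k}) fun il => B il.1 il.2) ?_ ?_ ?_⟩
  · rintro (k | ⟨i, l⟩)
    exacts [connected_induce_singleton G _, (hB i).connected l]
  · have root_disjoint (k i l) : Disjoint {![s, t] k} (B i l) :=
      Set.disjoint_singleton_left.2 fun hk => root_notMem k i (hBC i l hk)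
    rintro (k | ⟨i, k⟩) (l | ⟨j, l⟩) hkl
    · exact Set.disjoint_singleton.2 (root_ne fun h => hkl (congrArg _ h))
    · exact root_disjoint k j l
    · exact (root_disjoint l i k).symm
    · rcases eq_or_ne i j with rfl | hij
      · exact (hB i).disjoint fun h => hkl (congrArg _ (Prod.ext rfl h))
      · exact (h.disjoint hij).mono (hBC i k) (hBC j l)
  · rintro (k | ⟨i, k⟩) (l | ⟨j, l⟩) hkl
    · exact hkl.elim
    · rcases eq_or_ne k (ε j) with rfl | hk
      · exact (hB j).touches_left l (hkl.1 rfl)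
      · obtain rfl : l = 2 := not_not.1 (mt hkl.2 hk)
        obtain rfl : k = ε j + 1 := by lia
        exact (hB j).touches_right
    · exact hkl.elim
    · obtain ⟨rfl, hk, rfl⟩ := hkl
      exact (hB i).touches_mid k hk

/-- The end `inl k` of `thetaGraph` together with its neighbours on the paths with index in `J`. -/
def thetaStar (k : Fin 2) (J : Set (Fin 3)) : Set (Fin 2 ⊕ Fin 3 × Fin 2) :=
  insert (.inl k) ((fun i => .inr (i, k)) '' J)

lemma connected_thetaStar (k : Fin 2) (J : Set (Fin 3)) :
    (thetaGraph.induce (thetaStar k J)).Connected := by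
  refine connected_induce_of_forall_adj (Set.mem_insert _ _) ?_
  rintro _ (rfl | ⟨i, -, rfl⟩) hne
  · exact absurd rfl hne
  · simp [thetaGraph]

lemma disjoint_thetaStar {k l : Fin 2} (hkl : k ≠ l) (I J : Set (Fin 3)) :
    Disjoint (thetaStar k I) (thetaStar l J) := by
  grind [thetaStar]

/-- If `s` lay in the branch set next to `inl k` on the `j`-th path, then the rest of that side of
the model would be connected and avoid the cut, but meet two of its sides. -/
lemma IsTripleCut.mem_of_isModelOn_thetaGraph {B : Fin 2 ⊕ Fin 3 × Fin 2 → Set V}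
    (h : IsTripleCut G s t C) (hB : IsModelOn thetaGraph Set.univ G B) {k : Fin 2} {x : Fin 3 → V}
    (hx : ∀ i, x i ∈ B (.inr (i, k))) (hxC : ∀ i, x i ∈ insert s (C i))
    (hs : s ∈ ⋃ v ∈ thetaStar k Set.univ, B v) (ht : t ∉ ⋃ v ∈ thetaStar k Set.univ, B v) :
    s ∈ B (.inl k) := by
  obtain ⟨v, hv, hsv⟩ := Set.mem_iUnion₂.1 hs
  by_contra hsk
  obtain ⟨j, rfl⟩ : ∃ j, v = .inr (j, k) := by
    rcases hv with rfl | ⟨j, -, rfl⟩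
    exacts [absurd hsv hsk, ⟨j, rfl⟩]
  let S := ⋃ v ∈ thetaStar k {j}ᶜ, B v
  have hS : (G.induce S).Connected :=
    (hB.mono (Set.subset_univ _)).connected_biUnion (connected_thetaStar k _)
  have hsS : s ∉ S := by
    have : Disjoint {.inr (j, k)} (thetaStar k {j}ᶜ) := by simp [thetaStar]
    exact fun h => (hB.disjoint_biUnion this).notMem_of_mem_left (Set.mem_biUnion rfl hsv) h
  have htS : t ∉ S := fun h =>
    ht (Set.biUnion_subset_biUnion_left (Set.insert_subset_insert (Set.image_mono
      (Set.subset_univ _))) h)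
  have hSC {i} (hi : i ≠ j) : S ⊆ C i := by
    have hxS : x i ∈ S := Set.mem_biUnion (.inr ⟨i, hi, rfl⟩) (hx i)
    refine h.subset_of_preconnected hS.preconnected ?_ ⟨x i, hxS, ?_⟩
    · rintro v hv (rfl | rfl)
      exacts [hsS hv, htS hv]
    · exact (hxC i).resolve_left (ne_of_mem_of_not_mem hxS hsS)
  obtain ⟨v, hv⟩ := Set.nonempty_coe_sort.1 hS.nonempty
  have hdisj : Disjoint (C (j + 1)) (C (j + 2)) := h.disjoint (by simp)
  exact hdisj.notMem_of_mem_left (hSC (by simp) hv) (hSC (by simp) hv)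

lemma IsGeneralisedTriangle.exists_nontrivial_of_isMinor_thetaGraph
    (hG : IsGeneralisedTriangle G) (h : IsMinor thetaGraph G) :
    ∃ s t C, IsTripleCut G s t C ∧ ∀ i, (C i).Nontrivial := by
  obtain ⟨B, hB⟩ := isMinor_iff.1 h
  let side (k : Fin 2) := ⋃ v ∈ thetaStar k Set.univ, B v
  have hside (k) : (G.induce (side k)).Connected :=
    (hB.mono (Set.subset_univ _)).connected_biUnion (connected_thetaStar k _)
  have hdisj : Disjoint (side 0) (side 1) :=
    hB.disjoint_biUnion (disjoint_thetaStar zero_ne_one _ _)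
  have subset_side (i k) : B (.inr (i, k)) ⊆ side k :=
    Set.subset_biUnion_of_mem (u := B) (.inr ⟨i, trivial, rfl⟩)
  have hadj (i) : Touches G (B (.inr (i, 0))) (B (.inr (i, 1))) :=
    hB.touches _ _ trivial (by simp [thetaGraph])
  choose x hx y hy hxy using hadj
  have htriple : IsEdgeTriple G (side 0) (side 1) x y :=
    { connected_left := hside 0
      connected_right := hside 1
      disjoint := hdisj
      mem_left := fun i => subset_side i 0 (hx i)
      mem_right := fun i => subset_side i 1 (hy i)
      adj := hxy
      injective := fun i j hij => by
        by_contra hne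
        exact (hB.disjoint (show Sum.inr (i, 0) ≠ .inr (j, 0) by simpa using hne)).ne_of_mem
          (hx i) (hx j) (Prod.ext_iff.1 hij).1 }
  obtain ⟨s, hs, t, ht, C, hC, hxyC⟩ := hG.isSeparated htriple
  have hsB : s ∈ B (.inl 0) := hC.mem_of_isModelOn_thetaGraph hB hx (fun i => (hxyC i).1) hs
    (hdisj.notMem_of_mem_right ht)
  have htB : t ∈ B (.inl 1) := hC.symm.mem_of_isModelOn_thetaGraph hB hy (fun i => (hxyC i).2) ht
    (hdisj.notMem_of_mem_left hs)
  have ne_root {i k l a b} (ha : a ∈ B (.inr (i, k))) (hb : b ∈ B (.inl l)) : a ≠ b :=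
    (hB.disjoint Sum.inr_ne_inl).ne_of_mem ha hb
  exact ⟨s, t, C, hC, fun i => ⟨x i, (hxyC i).1.resolve_left (ne_root (hx i) hsB),
    y i, (hxyC i).2.resolve_left (ne_root (hy i) htB), (hxy i).ne⟩⟩

lemma IsGeneralisedTriangle.isMinor_H1_or_isMinor_H2_iff (hG : IsGeneralisedTriangle G) :
    IsMinor H1 G ∨ IsMinor H2 G ↔ ∃ s t C, IsTripleCut G s t C ∧ ∀ i, (C i).Nontrivial := by
  constructor
  · have theta_isMinor {ε} (h : IsMinor (subdividedK23 ε) G) : IsMinor thetaGraph G :=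
      h.of_isContained <| (thetaGraph_isContained_doubledK23 ε).trans
        (subdividedK23Iso ε).isContained'
    rintro (h | h)
    · exact hG.exists_nontrivial_of_isMinor_thetaGraph (theta_isMinor (ε := ![0, 0, 0]) h)
    · exact hG.exists_nontrivial_of_isMinor_thetaGraph (theta_isMinor (ε := ![0, 0, 1]) h)
  · rintro ⟨s, t, C, h, hC⟩
    obtain ⟨ε, hε⟩ := h.isMinor_doubledK23 hC
    exact (H1_isContained_or_H2_isContained ε).imp hε.of_isContained hε.of_isContained

end NontrivialTripleCuts

section TwoCuts

variable {V : Type u} {G : SimpleGraph V} {s t : V} {C : Fin 3 → Set V}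

lemma IsTripleCut.isBridge_iff (h : IsTripleCut G s t C) {B : G.Subgraph} :
    IsBridge G s t B ↔ ∃ i, B = (⊤ : G.Subgraph).induce (C i ∪ {s, t}) := by
  have image_supp {i} {v : ({s, t}ᶜ : Set V)} (hv : ↑v ∈ C i) :
      (↑) '' ((G.induce {s, t}ᶜ).connectedComponentMk v).supp = C i :=
    image_supp_connectedComponentMk (h.rich i).connected
      (fun _ ha _ hb hab => h.mem_of_adj ha hb hab) (h.subset_compl i) hv
  constructor
  · rintro ⟨c, rfl⟩
    induction c using SimpleGraph.ConnectedComponent.ind with | _ v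
    obtain ⟨i, hi⟩ := Set.mem_iUnion.1 (h.iUnion.superset v.2)
    exact ⟨i, by rw [image_supp hi]⟩
  · rintro ⟨i, rfl⟩
    obtain ⟨v, hv⟩ := (h.rich i).nonempty
    exact ⟨_, by rw [image_supp (v := ⟨v, h.subset_compl i hv⟩) hv]⟩

lemma IsTripleCut.ncard_union_pair_eq_three_iff (h : IsTripleCut G s t C) (i : Fin 3) :
    (C i ∪ {s, t}).ncard = 3 ↔ ¬(C i).Nontrivial := by
  have hcard (hfin : (C i).Finite) : (C i ∪ {s, t}).ncard = (C i).ncard + 2 := by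
    rw [Set.ncard_union_eq _ hfin, Set.ncard_pair h.ne]
    simpa using ⟨h.notMem i, h.symm.notMem i⟩
  rw [Set.not_nontrivial_iff]
  constructor
  · intro h3
    have hfin : (C i ∪ {s, t}).Finite := Set.finite_of_ncard_ne_zero (by lia)
    have : Finite (C i) := hfin.subset Set.subset_union_left
    rw [hcard this] at h3
    exact Set.ncard_le_one_iff_subsingleton.1 (by lia)
  · intro hsub
    obtain ⟨v, hv⟩ :=
      Set.exists_eq_singleton_iff_nonempty_subsingleton.2 ⟨(h.rich i).nonempty, hsub⟩
    rw [hcard hsub.finite, hv, Set.ncard_singleton]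

lemma IsTripleCut.hasP2_iff (h : IsTripleCut G s t C) : HasP2 G s t ↔ ∃ i, ¬(C i).Nontrivial := by
  simp [HasP2, h.isBridge_iff, ← h.ncard_union_pair_eq_three_iff]

lemma IsGeneralisedTriangle.isTwoCut_iff (hG : IsGeneralisedTriangle G) :
    IsTwoCut G s t ↔ ∃ C, IsTripleCut G s t C := by
  have : Nonempty V := ⟨s⟩
  rw [IsTwoCut, isCutSet_iff ⟨hG.preconnected⟩]
  constructor
  · rintro ⟨hst, hcut⟩
    exact (hG.connected_compl_pair_or_isTripleCut hst).resolve_left (hcut ·.preconnected)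
  · rintro ⟨C, h⟩
    refine ⟨h.ne, fun hpre => ?_⟩
    obtain ⟨v, hv⟩ := (h.rich 0).nonempty
    obtain ⟨w, hw⟩ := (h.rich 1).nonempty
    have hw0 : w ∈ C 0 :=
      h.subset_of_preconnected hpre subset_rfl ⟨v, h.subset_compl 0 hv, hv⟩ (h.subset_compl 1 hw)
    exact (h.disjoint zero_ne_one).notMem_of_mem_left hw0 hw

end TwoCuts

end GenTriangle

theorem lemma19 {V : Type*} (G : SimpleGraph V) (hG : GenTriangle.IsGeneralisedTriangle G) :
    GenTriangle.InK2 G ↔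
      (¬ GenTriangle.IsMinor GenTriangle.H1 G ∧ ¬ GenTriangle.IsMinor GenTriangle.H2 G) := by
  rw [← not_or, hG.isMinor_H1_or_isMinor_H2_iff]
  constructor
  · rintro ⟨-, hK⟩ ⟨s, t, C, h, hC⟩
    obtain ⟨i, hi⟩ := h.hasP2_iff.1 (hK s t (hG.isTwoCut_iff.2 ⟨C, h⟩))
    exact hi (hC i)
  · intro hno
    refine ⟨hG, fun s t hst => ?_⟩
    obtain ⟨C, h⟩ := hG.isTwoCut_iff.1 hst
    refine h.hasP2_iff.2 ?_
    by_contra! hC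
    exact hno ⟨s, t, C, h, hC⟩
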